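/- Let $k,t,n$ be non-negative integers with $0\le t<k$. A $k_t$-Dyck path of length $(k+1)n$ is a lattice path from $(0,0)$ to $((k+1)n,0)$ consisting of $kn$ up-steps $(1,1)$ and $n$ down-steps $(1,-k)$ that stays weakly above the line $y=-t$. A down-step is said to be at height $i$ modulo $k$ if the height (second coordinate) of its endpoint is congruent to $i$ modulo $k$. Let $1\le i\le k$, and let $T_i$ be the total number of down-steps at height $i$ modulo $k$, summed over all $k_t$-Dyck paths of length $(k+1)n$. With the convention $\binom{m}{j}=0$ for $j<0$: 1. If $k-t\le i\le k$, then $$T_i=\frac{(t+1)n+k+1}{n-1}\binom{(k+1)n+t}{n-2}\quad\text{for } n\neq 1,$$ and $T_i=1$ for $n=1$. 2. If $1\le i\le k-t-1$, then $$T_i=(t+1)\binom{(k+1)n+t}{n-2}.$$ -/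

import Mathlib

namespace KtDyck

/-- The two kinds of lattice steps: the up-step `(1, 1)` and the down-step `(1, -k)`. -/
inductive Step where
  | up
  | down
  deriving DecidableEq

instance : Fintype Step where
  elems := {Step.up, Step.down}
  complete := fun s => by cases s <;> simp

/-- The change of the second coordinate along a step. -/
def Step.rise (k : ℕ) : Step → ℤ
  | .up => 1
  | .down => -(k : ℤ)

/-- The height (second coordinate) of the endpoint of the lattice path that starts at `(0, 0)` and
takes the given steps in order; its first coordinate is the number of steps. -/
def height (k : ℕ) (w : List Step) : ℤ := (w.map (Step.rise k)).sum

/-- The sequence of steps `w` is a `k_t`-Dyck path of length `(k + 1) n`: it has `n` down-steps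
and `k n` up-steps, it ends at `((k + 1) n, 0)`, and all its vertices (equivalently, all
its points) are weakly above the line `y = -t`. -/
structure IsKtDyckPath (k t n : ℕ) (w : List Step) : Prop where
  length_eq : w.length = (k + 1) * n
  count_down : w.count Step.down = n
  count_up : w.count Step.up = k * n
  end_height : height k w = 0
  above : ∀ j ≤ w.length, -(t : ℤ) ≤ height k (w.take j)

open Classical in
/-- The finite set of all `k_t`-Dyck paths of length `(k + 1) n`. -/
noncomputable def ktDyckPaths (k t n : ℕ) : Finset (List Step) :=
  ((Finset.univ : Finset (Fin ((k + 1) * n) → Step)).image List.ofFn).filter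
    (IsKtDyckPath k t n)

theorem mem_ktDyckPaths {k t n : ℕ} {w : List Step} :
    w ∈ ktDyckPaths k t n ↔ IsKtDyckPath k t n w := by
  classical
  simp only [ktDyckPaths, Finset.mem_filter, Finset.mem_image, Finset.mem_univ, true_and,
    and_iff_right_iff_imp]
  intro h
  refine ⟨fun j => w.get (j.cast h.length_eq.symm), ?_⟩
  apply List.ext_getElem
  · simp [h.length_eq]
  · intro m h1 h2
    simp

/-- The number of down-steps of the path `w` whose endpoint is at a height congruent to `i`
modulo `k`. The step in position `j` (counted from `0`) ends after the first `j + 1` steps. -/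
def downStepsAt (k i : ℕ) (w : List Step) : ℕ :=
  ((Finset.range w.length).filter fun j =>
    w[j]? = some Step.down ∧ height k (w.take (j + 1)) ≡ (i : ℤ) [ZMOD (k : ℤ)]).card

/-- The total number of down-steps at a height of `i` modulo `k` in all `k_t`-Dyck paths of
length `(k + 1) n`. -/
noncomputable def totalDownStepsAt (k t n i : ℕ) : ℕ :=
  ∑ w ∈ ktDyckPaths k t n, downStepsAt k i w

/-- The binomial coefficient `m` choose `j` for an integer `j`, equal to `0` if `j < 0`. -/
def binom (m : ℕ) (j : ℤ) : ℕ := if 0 ≤ j then m.choose j.toNat else 0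

end KtDyck

namespace KtDyck

open Finset

/-! A down-step changes the height by `-k`, so modulo `k` its endpoint is at the number of up-steps
before it. Thus T_i counts the down-steps preceded by v ≡ i up-steps. Exchanging the run of
down-steps after v up-steps with the run after v + 1 respects the boundary unless `k` divides v + 1
+ t, for otherwise both runs are limited by the same bound ⌊(v + t)/k⌋. Only the trailing run, which
has no successor, is left unmatched. `boundedDownSteps_sub_succ` proves this by induction on the
last step.

Hence T_i is constant on 1 ≤ i < k - t and on k - t ≤ i ≤ k. If both ranges are nonempty, the values
differ by the total length D of the trailing runs, which is the number of paths with kn + 1 up-steps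
and n - 1 down-steps (`sum_card_boundedPaths`). Since the T_i add up to n times the number of paths
(`sum_boundedDownSteps`), both values follow from the ballot formula `card_boundedPaths`. -/

/-! ### Heights, the boundary, and appending a last step -/

theorem height_append_singleton (k : ℕ) (w : List Step) (s : Step) :
    height k (w ++ [s]) = height k w + s.rise k := by
  simp [height]

theorem height_eq_count (k : ℕ) (w : List Step) :
    height k w = (w.count Step.up : ℤ) - k * w.count Step.down := by
  induction w using List.reverseRecOn with
  | nil => simp [height]
  | append_singleton w s ih =>
    rw [height_append_singleton, ih]
    cases s <;> simp [Step.rise] <;> ring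

theorem length_eq_count (w : List Step) :
    w.length = w.count Step.up + w.count Step.down := by
  induction w with
  | nil => simp
  | cons s w ih => cases s <;> simp [ih] <;> omega

/-- All vertices of the path `w` are weakly above the line `y = -t`. -/
def StaysAbove (k t : ℕ) (w : List Step) : Prop :=
  ∀ j ≤ w.length, -(t : ℤ) ≤ height k (w.take j)

theorem staysAbove_nil (k t : ℕ) : StaysAbove k t [] := by
  intro j _
  simp [height]

theorem staysAbove_append_singleton {k t : ℕ} {w : List Step} {s : Step} :
    StaysAbove k t (w ++ [s]) ↔
      StaysAbove k t w ∧ -(t : ℤ) ≤ height k (w ++ [s]) := by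
  constructor
  · intro h
    refine ⟨fun j hj => ?_, ?_⟩
    · have := h j (by simp; omega)
      rwa [List.take_append_of_le_length hj] at this
    · have := h (w ++ [s]).length le_rfl
      rwa [List.take_length] at this
  · rintro ⟨h, h'⟩ j hj
    rcases Nat.lt_or_ge w.length j with hlt | hle
    · rwa [List.take_of_length_le (by simp; omega)]
    · rw [List.take_append_of_le_length hle]
      exact h j hle

theorem StaysAbove.le_height {k t : ℕ} {w : List Step} (h : StaysAbove k t w) :
    -(t : ℤ) ≤ height k w := by
  simpa using h w.length le_rfl

theorem downStepsAt_append_singleton (k i : ℕ) (w : List Step) (s : Step) :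
    downStepsAt k i (w ++ [s]) = downStepsAt k i w +
      if s = Step.down ∧ height k (w ++ [s]) ≡ (i : ℤ) [ZMOD (k : ℤ)] then 1 else 0 := by
  unfold downStepsAt
  rw [List.length_append, List.length_singleton, range_add_one, filter_insert]
  have hcongr : ((range w.length).filter fun j =>
        (w ++ [s])[j]? = some Step.down ∧
          height k ((w ++ [s]).take (j + 1)) ≡ (i : ℤ) [ZMOD (k : ℤ)]) =
      (range w.length).filter fun j =>
        w[j]? = some Step.down ∧ height k (w.take (j + 1)) ≡ (i : ℤ) [ZMOD (k : ℤ)] := by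
    apply filter_congr
    intro j hj
    have hj' := mem_range.mp hj
    rw [List.getElem?_append_left hj', List.take_append_of_le_length hj']
  rw [hcongr]
  have hlast : (w ++ [s])[w.length]? = some s := by simp
  have htake : (w ++ [s]).take (w.length + 1) = w ++ [s] :=
    List.take_of_length_le (by simp)
  simp only [hlast, htake, Option.some.injEq]
  split_ifs
  · rw [card_insert_of_notMem (by simp)]
  · rfl

/-! ### Recursive enumeration of bounded paths -/

/-- The paths with `u` up-steps and `d` down-steps that stay weakly above `y = -t`
(for `t < k`), built by appending the last step. -/
def boundedPaths (k t : ℕ) : ℕ → ℕ → Finset (List Step)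
  | 0, 0 => {[]}
  | u + 1, 0 => (boundedPaths k t u 0).image (· ++ [Step.up])
  | 0, _ + 1 => ∅
  | u + 1, d + 1 =>
    if k * (d + 1) ≤ u + 1 + t then
      (boundedPaths k t u (d + 1)).image (· ++ [Step.up]) ∪
        (boundedPaths k t (u + 1) d).image (· ++ [Step.down])
    else ∅

theorem append_singleton_mem_image {S : Finset (List Step)} {w : List Step} {s r : Step} :
    w ++ [s] ∈ S.image (· ++ [r]) ↔ w ∈ S ∧ s = r := by
  rw [mem_image]
  constructor
  · rintro ⟨v, hv, h⟩
    obtain ⟨rfl, h⟩ := List.append_inj' h rfl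
    exact ⟨hv, by simpa using h.symm⟩
  · rintro ⟨hw, rfl⟩
    exact ⟨w, hw, rfl⟩

/-- Only the final vertex needs testing at each stage, and only its counts matter. As `t < k`, no
path can begin with a down-step, which justifies the empty case `0, _ + 1`. -/
theorem mem_boundedPaths {k t : ℕ} (htk : t < k) {u d : ℕ} {w : List Step} :
    w ∈ boundedPaths k t u d ↔
      w.count Step.up = u ∧ w.count Step.down = d ∧ StaysAbove k t w := by
  induction w using List.reverseRecOn generalizing u d with
  | nil =>
    have := staysAbove_nil k t
    match u, d with
    | 0, 0 => simp [boundedPaths, this]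
    | u + 1, 0 => simp [boundedPaths]
    | 0, d + 1 => simp [boundedPaths]
    | u + 1, d + 1 =>
      rw [boundedPaths]
      split_ifs <;> simp
  | append_singleton w s ih =>
    rw [staysAbove_append_singleton]
    have hle : StaysAbove k t w → -(t : ℤ) ≤ height k w := StaysAbove.le_height
    match u, d with
    | 0, 0 => cases s <;> simp [boundedPaths]
    | u + 1, 0 =>
      rw [boundedPaths, append_singleton_mem_image, ih, height_append_singleton]
      cases s
      · simp only [List.count_append, List.count_singleton, Step.rise]
        simp
        intro _ _ h
        have := hle h
        omega
      · simp
    | 0, d + 1 =>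
      simp only [boundedPaths, notMem_empty, false_iff]
      rintro ⟨hu, hd, _, h⟩
      rw [height_eq_count, hu, hd] at h
      push_cast at h
      nlinarith
    | u + 1, d + 1 =>
      rw [boundedPaths]
      split_ifs with hv
      · rw [mem_union, append_singleton_mem_image, append_singleton_mem_image, ih, ih]
        have hv' : (k : ℤ) * (d + 1) ≤ u + 1 + t := by exact_mod_cast hv
        constructor
        · rintro (⟨⟨h1, h2, h3⟩, rfl⟩ | ⟨⟨h1, h2, h3⟩, rfl⟩)
          all_goals
            refine ⟨by simp [h1], by simp [h2], h3, ?_⟩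
            rw [height_eq_count]
            simp [h1, h2]
            linarith
        · rintro ⟨h1, h2, h3, -⟩
          cases s <;> simp at h1 h2 <;> simp [h1, h2, h3]
      · simp only [notMem_empty, false_iff]
        rintro ⟨hu, hd, _, h⟩
        rw [height_eq_count, hu, hd] at h
        apply hv
        zify
        push_cast at h
        linarith

theorem ktDyckPaths_eq_boundedPaths {k t : ℕ} (htk : t < k) (n : ℕ) :
    ktDyckPaths k t n = boundedPaths k t (k * n) n := by
  ext w
  rw [mem_ktDyckPaths, mem_boundedPaths htk]
  constructor
  · intro h
    exact ⟨h.count_up, h.count_down, h.above⟩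
  · rintro ⟨h1, h2, h3⟩
    refine ⟨?_, h2, h1, ?_, h3⟩
    · rw [length_eq_count, h1, h2]
      ring
    · rw [height_eq_count, h1, h2]
      push_cast
      ring

theorem append_singleton_injective (s : Step) :
    Function.Injective fun w : List Step => w ++ [s] :=
  List.append_left_injective [s]

theorem sum_boundedPaths_succ_succ {k t u d : ℕ} (hv : k * (d + 1) ≤ u + 1 + t)
    (f : List Step → ℕ) :
    ∑ w ∈ boundedPaths k t (u + 1) (d + 1), f w =
      ∑ w ∈ boundedPaths k t u (d + 1), f (w ++ [Step.up]) +
        ∑ w ∈ boundedPaths k t (u + 1) d, f (w ++ [Step.down]) := by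
  rw [boundedPaths, if_pos hv, sum_union, sum_image (append_singleton_injective _).injOn,
    sum_image (append_singleton_injective _).injOn]
  rw [disjoint_left]
  intro w h1 h2
  obtain ⟨v, -, rfl⟩ := mem_image.mp h1
  simpa using (append_singleton_mem_image.mp h2).2

theorem boundedPaths_eq_empty {k t u d : ℕ} (h : u + t < k * d) :
    boundedPaths k t u d = ∅ := by
  match u, d with
  | u, 0 => simp at h
  | 0, d + 1 => rw [boundedPaths]
  | u + 1, d + 1 => rw [boundedPaths, if_neg (by omega)]

/-! ### Ballot numbers -/

theorem card_boundedPaths_zero_right (k t u : ℕ) : (boundedPaths k t u 0).card = 1 := by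
  induction u with
  | zero => simp [boundedPaths]
  | succ u ih => rw [boundedPaths, card_image_of_injective _ (append_singleton_injective _), ih]

theorem card_boundedPaths_succ_succ {k t u d : ℕ} (hv : k * (d + 1) ≤ u + 1 + t) :
    (boundedPaths k t (u + 1) (d + 1)).card =
      (boundedPaths k t u (d + 1)).card + (boundedPaths k t (u + 1) d).card := by
  simpa using sum_boundedPaths_succ_succ hv fun _ => 1

/-- Both sides satisfy the same Pascal-type recursion. The range reaches one unit past the boundary,
where both sides vanish, because the predecessor with one up-step fewer may lie there. -/
theorem card_boundedPaths {k t : ℕ} (htk : t < k) (u d : ℕ) (h : k * d ≤ u + t + 1) :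
    ((boundedPaths k t u d).card : ℚ) * (u + t + 1) =
      ((u : ℚ) + t + 1 - k * d) * (u + t + d).choose d := by
  induction u generalizing d with
  | zero =>
    cases d with
    | zero => simp [card_boundedPaths_zero_right]
    | succ d =>
      -- `t < k` gives the reverse inequality, so this is the line where both sides vanish.
      have hd : k * (d + 1) = t + 1 := by nlinarith
      have hd' : (k : ℚ) * (d + 1) = t + 1 := by exact_mod_cast hd
      simp [boundedPaths, hd']
  | succ u ihu =>
    induction d with
    | zero => simp [card_boundedPaths_zero_right]
    | succ d ihd =>
      rcases h.eq_or_lt with h | h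
      · rw [boundedPaths_eq_empty (by omega)]
        have h' : (k : ℚ) * (d + 1) = u + 1 + t + 1 := by exact_mod_cast h
        push_cast
        rw [h']
        simp
      · have e1 := ihu (d + 1) (by omega)
        have e2 := ihd (by nlinarith)
        rw [card_boundedPaths_succ_succ (by omega)]
        have c1 : ((u + t + (d + 1)).choose (d + 1) : ℚ) * (d + 1) =
            (u + t + 1 + d).choose d * (u + t + 1) := by
          have := Nat.choose_succ_right_eq (u + t + 1 + d) d
          rw [Nat.add_sub_cancel, show u + t + 1 + d = u + t + (d + 1) by ring] at this
          rw [show u + t + 1 + d = u + t + (d + 1) by ring]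
          exact_mod_cast this
        have c2 : (((u + 1 : ℕ) + t + (d + 1)).choose (d + 1) : ℚ) =
            (u + t + 1 + d).choose d + (u + t + (d + 1)).choose (d + 1) := by
          rw [show u + 1 + t + (d + 1) = u + t + 1 + d + 1 by ring, Nat.choose_succ_succ,
            show u + t + 1 + d = u + t + (d + 1) by ring]
          push_cast
          ring
        rw [show u + 1 + t + d = u + t + 1 + d by ring] at e2
        rw [c2]
        push_cast at e1 e2 ⊢
        set P := ((boundedPaths k t u (d + 1)).card : ℚ)
        set Q := ((boundedPaths k t (u + 1) d).card : ℚ)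
        set X := ((u + t + (d + 1)).choose (d + 1) : ℚ)
        set Y := ((u + t + 1 + d).choose d : ℚ)
        have hpos : (u : ℚ) + t + 1 ≠ 0 := by positivity
        apply mul_right_cancel₀ hpos
        linear_combination ((u : ℚ) + t + 2) * e1 + ((u : ℚ) + t + 1) * e2 - k * c1

/-- Split the paths by the number `j` of down-steps before the last up-step; the down-steps after it
are admissible as soon as the endpoint is. -/
theorem sum_card_boundedPaths {k t u d : ℕ} (h : k * d ≤ u + 1 + t) :
    ∑ j ∈ range (d + 1), (boundedPaths k t u j).card = (boundedPaths k t (u + 1) d).card := by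
  induction d with
  | zero => simp [card_boundedPaths_zero_right]
  | succ d ih =>
    rw [sum_range_succ, ih (by nlinarith), card_boundedPaths_succ_succ h, add_comm]

/-! ### Down-steps by residue -/

/-- The number of down-steps at height `i` modulo `k` in all bounded paths with `u` up-steps
and `d` down-steps. -/
def boundedDownSteps (k t i u d : ℕ) : ℕ :=
  ∑ w ∈ boundedPaths k t u d, downStepsAt k i w

theorem boundedDownSteps_zero_right {k t : ℕ} (i u : ℕ) :
    boundedDownSteps k t i u 0 = 0 := by
  induction u with
  | zero => simp [boundedDownSteps, boundedPaths, downStepsAt]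
  | succ u ih =>
    unfold boundedDownSteps at ih ⊢
    rw [boundedPaths, sum_image (append_singleton_injective _).injOn]
    simpa [downStepsAt_append_singleton] using ih

theorem boundedDownSteps_of_lt {k t : ℕ} (i : ℕ) {u d : ℕ} (h : u + t < k * d) :
    boundedDownSteps k t i u d = 0 := by
  simp [boundedDownSteps, boundedPaths_eq_empty h]

theorem boundedDownSteps_succ_succ {k t : ℕ} (htk : t < k) (i : ℕ) {u d : ℕ}
    (hv : k * (d + 1) ≤ u + 1 + t) :
    boundedDownSteps k t i (u + 1) (d + 1) =
      boundedDownSteps k t i u (d + 1) + boundedDownSteps k t i (u + 1) d +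
        if u + 1 ≡ i [MOD k] then (boundedPaths k t (u + 1) d).card else 0 := by
  unfold boundedDownSteps
  rw [sum_boundedPaths_succ_succ hv, add_assoc]
  congr 1
  · simp [downStepsAt_append_singleton]
  · have hstep : ∀ w ∈ boundedPaths k t (u + 1) d,
        downStepsAt k i (w ++ [Step.down]) =
          downStepsAt k i w + if u + 1 ≡ i [MOD k] then 1 else 0 := by
      intro w hw
      obtain ⟨hu, hd, -⟩ := (mem_boundedPaths htk).mp hw
      rw [downStepsAt_append_singleton]
      congr 1
      have hh : height k (w ++ [Step.down]) = ((u + 1 : ℕ) : ℤ) + k * (-(d + 1)) := by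
        rw [height_append_singleton, height_eq_count, hu, hd, Step.rise]
        ring
      have hmod : height k (w ++ [Step.down]) ≡ (i : ℤ) [ZMOD (k : ℤ)] ↔
          u + 1 ≡ i [MOD k] := by
        rw [hh, ← Int.natCast_modEq_iff]
        simp [Int.ModEq]
      simp [hmod]
    rw [sum_congr rfl hstep, sum_add_distrib]
    congr 1
    split_ifs <;> simp

/-- Consecutive residues that are not separated by the boundary `y = -t` get equally many
down-steps, except for the trailing down-steps. -/
theorem boundedDownSteps_sub_succ {k t i : ℕ} (htk : t < k) (hk : 1 < k)
    (hi : ¬ k ∣ i + 1 + t) (u d : ℕ) (hv : k * d ≤ u + t) :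
    (boundedDownSteps k t i u d : ℤ) - boundedDownSteps k t (i + 1) u d =
      if u ≡ i [MOD k] then ((∑ j ∈ range d, (boundedPaths k t u j).card : ℕ) : ℤ) else 0 := by
  have hne : ∀ v, v ≡ i [MOD k] → ¬ v + 1 ≡ i [MOD k] := by
    intro v h1 h2
    have h3 : v + 1 ≡ v + 0 [MOD k] := h2.trans h1.symm
    have h4 := Nat.ModEq.add_left_cancel' v h3
    rw [Nat.modEq_zero_iff_dvd, Nat.dvd_one] at h4
    omega
  induction u generalizing d with
  | zero =>
    have hd : d = 0 := by
      rcases d with _ | d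
      · rfl
      · nlinarith
    subst hd
    simp [boundedDownSteps_zero_right]
  | succ u ihu =>
    induction d with
    | zero => simp [boundedDownSteps_zero_right]
    | succ d ihd =>
      have e2 := ihd (by nlinarith)
      rw [boundedDownSteps_succ_succ htk i hv, boundedDownSteps_succ_succ htk (i + 1) hv]
      have hsucc : u + 1 ≡ i + 1 [MOD k] ↔ u ≡ i [MOD k] :=
        ⟨Nat.ModEq.add_right_cancel' 1, Nat.ModEq.add_right 1⟩
      by_cases h1 : u ≡ i [MOD k]
      -- Otherwise the path would end exactly on y = -t, forcing `k ∣ i + 1 + t`.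
      · have hlt : k * (d + 1) ≤ u + t := by
          by_contra hcon
          have heq : u + 1 + t = k * (d + 1) := by omega
          have hmod : i + 1 + t ≡ u + 1 + t [MOD k] := ((hsucc.mpr h1).add_right t).symm
          rw [heq] at hmod
          exact hi (Nat.modEq_zero_iff_dvd.mp
            (hmod.trans (Nat.modEq_zero_iff_dvd.mpr (dvd_mul_right _ _))))
        have e1 := ihu (d + 1) hlt
        -- The trailing excess becomes the number of paths to `(u + 1, d)`, which the new last
        -- down-steps of residue `i + 1` cancel.
        rw [if_pos h1, sum_card_boundedPaths (by nlinarith)] at e1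
        rw [if_neg (hne u h1)] at e2 ⊢
        rw [if_pos (hsucc.mpr h1), if_neg (hne u h1)]
        push_cast
        linarith
      · have e1 : (boundedDownSteps k t i u (d + 1) : ℤ) =
            boundedDownSteps k t (i + 1) u (d + 1) := by
          rcases Nat.lt_or_ge (u + t) (k * (d + 1)) with hlt | hge
          · rw [boundedDownSteps_of_lt i hlt, boundedDownSteps_of_lt (i + 1) hlt]
          · have e1 := ihu (d + 1) hge
            rw [if_neg h1] at e1
            linarith
        rw [if_neg (mt hsucc.mp h1)]
        -- If true, the new last down-steps have residue `i` and add the term `j = d` to the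
        -- trailing sum.
        by_cases h2 : u + 1 ≡ i [MOD k]
        · rw [if_pos h2] at e2 ⊢
          rw [if_pos h2, sum_range_succ]
          push_cast at e2 ⊢
          linarith
        · rw [if_neg h2] at e2 ⊢
          rw [if_neg h2]
          push_cast
          linarith

theorem sum_ite_modEq {k : ℕ} (hk : 0 < k) (u c : ℕ) :
    ∑ i ∈ range k, (if u ≡ i + 1 [MOD k] then c else 0) = c := by
  have hiff : ∀ i ∈ range k, (u ≡ i + 1 [MOD k] ↔ (u + (k - 1)) % k = i) := by
    intro i hi
    have hi' := mem_range.mp hi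
    have : u ≡ i + 1 [MOD k] ↔ u + (k - 1) ≡ i + 1 + (k - 1) [MOD k] :=
      ⟨Nat.ModEq.add_right _, Nat.ModEq.add_right_cancel' _⟩
    rw [this, show i + 1 + (k - 1) = i + k by omega, Nat.ModEq, Nat.add_mod_right,
      Nat.mod_eq_of_lt hi']
  rw [sum_congr rfl fun i hi => if_congr (hiff i hi) rfl rfl, sum_ite_eq,
    if_pos (mem_range.mpr (Nat.mod_lt _ hk))]

theorem sum_boundedDownSteps {k t : ℕ} (htk : t < k) (u d : ℕ) :
    ∑ i ∈ range k, boundedDownSteps k t (i + 1) u d = d * (boundedPaths k t u d).card := by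
  induction u generalizing d with
  | zero =>
    cases d with
    | zero => simp [boundedDownSteps_zero_right]
    | succ d => simp [boundedDownSteps, boundedPaths]
  | succ u ihu =>
    induction d with
    | zero => simp [boundedDownSteps_zero_right]
    | succ d ihd =>
      rcases Nat.lt_or_ge (u + 1 + t) (k * (d + 1)) with hlt | hge
      · simp [boundedDownSteps, boundedPaths_eq_empty hlt]
      · rw [sum_congr rfl fun i _ => boundedDownSteps_succ_succ htk (i + 1) hge,
          sum_add_distrib, sum_add_distrib, ihu, ihd, sum_ite_modEq (by omega),
          card_boundedPaths_succ_succ hge]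
        ring

/-! ### Comparing the residues for Dyck paths -/

section Residues

variable {k t n : ℕ}

theorem boundedDownSteps_succ_eq (htk : t < k) {i : ℕ} (hi1 : 1 ≤ i) (hik : i < k)
    (hi : i + 1 + t ≠ k) :
    boundedDownSteps k t (i + 1) (k * n) n = boundedDownSteps k t i (k * n) n := by
  -- Here 0 < i + 1 + t < 2k, so `k` is the only possible multiple.
  have hndvd : ¬ k ∣ i + 1 + t := by
    rintro ⟨c, hc⟩
    rcases c with _ | _ | c
    · omega
    · omega
    · nlinarith
  have h := boundedDownSteps_sub_succ htk (by omega) hndvd (k * n) n (by omega)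
  have hmod : ¬ k * n ≡ i [MOD k] := by
    intro hcon
    have h0 : i ≡ 0 [MOD k] :=
      hcon.symm.trans (Nat.modEq_zero_iff_dvd.mpr (dvd_mul_right _ _))
    exact absurd (Nat.le_of_dvd hi1 (Nat.modEq_zero_iff_dvd.mp h0)) (by omega)
  rw [if_neg hmod] at h
  omega

theorem boundedDownSteps_eq_of_ge (htk : t < k) {i : ℕ} (hi1 : 1 ≤ i) (hti : k - t ≤ i)
    (hik : i ≤ k) :
    boundedDownSteps k t i (k * n) n = boundedDownSteps k t k (k * n) n := by
  induction hik using Nat.decreasingInduction with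
  | self => rfl
  | of_succ j hj ih =>
    rw [← ih (by omega) (by omega), boundedDownSteps_succ_eq htk hi1 hj (by omega)]

theorem boundedDownSteps_eq_of_lt (htk : t < k) {i : ℕ} (hi1 : 1 ≤ i) (hik : i + t < k) :
    boundedDownSteps k t i (k * n) n = boundedDownSteps k t 1 (k * n) n := by
  induction i, hi1 using Nat.le_induction with
  | base => rfl
  | succ j hj ih =>
    rw [boundedDownSteps_succ_eq htk hj (by omega) (by omega), ih (by omega)]

theorem boundedDownSteps_congr {i j : ℕ} (h : i ≡ j [MOD k]) (u d : ℕ) :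
    boundedDownSteps k t i u d = boundedDownSteps k t j u d := by
  have h' (a : ℤ) : a ≡ i [ZMOD k] ↔ a ≡ j [ZMOD k] :=
    ⟨fun ha => ha.trans (Int.natCast_modEq_iff.mpr h),
      fun ha => ha.trans (Int.natCast_modEq_iff.mpr h.symm)⟩
  simp only [boundedDownSteps, downStepsAt, h']

/-- This is the cyclic passage from residue `k` to `k + 1 ≡ 1`. As `k * n ≡ k`, the trailing runs
contribute here. -/
theorem boundedDownSteps_eq_add (htk : t + 1 < k) (hn : 1 ≤ n) :
    boundedDownSteps k t k (k * n) n =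
      boundedDownSteps k t 1 (k * n) n + (boundedPaths k t (k * n + 1) (n - 1)).card := by
  have hndvd : ¬ k ∣ k + 1 + t := by
    rw [add_assoc, Nat.dvd_add_right dvd_rfl]
    exact Nat.not_dvd_of_pos_of_lt (by omega) (by omega)
  have h := boundedDownSteps_sub_succ (by omega) (by omega) hndvd (k * n) n (by omega)
  have hmod : k * n ≡ k [MOD k] :=
    (Nat.modEq_zero_iff_dvd.mpr (dvd_mul_right _ _)).trans
      (Nat.modEq_zero_iff_dvd.mpr dvd_rfl).symm
  rw [if_pos hmod, boundedDownSteps_congr (i := k + 1) (j := 1) (by simp [Nat.ModEq])] at h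
  obtain ⟨m, rfl⟩ : ∃ m, n = m + 1 := ⟨n - 1, by omega⟩
  rw [sum_card_boundedPaths (by nlinarith)] at h
  simp only [Nat.add_sub_cancel]
  omega

theorem boundedDownSteps_eq_sub (htk : t < k) (hn : 1 ≤ n) {i : ℕ} (hi1 : 1 ≤ i)
    (hik : i ≤ k) :
    (boundedDownSteps k t i (k * n) n : ℚ) = boundedDownSteps k t k (k * n) n -
      if k - t ≤ i then 0 else ((boundedPaths k t (k * n + 1) (n - 1)).card : ℚ) := by
  split_ifs with h
  · rw [boundedDownSteps_eq_of_ge htk hi1 h hik, sub_zero]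
  · rw [boundedDownSteps_eq_of_lt htk hi1 (by omega), boundedDownSteps_eq_add (by omega) hn]
    push_cast
    ring

/-- Sum `boundedDownSteps_eq_sub` over all residues; exactly `k - t - 1` of them carry the deficit.
-/
theorem mul_boundedDownSteps (htk : t < k) (hn : 1 ≤ n) :
    (k : ℚ) * boundedDownSteps k t k (k * n) n =
      n * (boundedPaths k t (k * n) n).card +
        (k - t - 1) * (boundedPaths k t (k * n + 1) (n - 1)).card := by
  have h := sum_boundedDownSteps htk (k * n) n
  have h' : ∑ i ∈ range k, (boundedDownSteps k t (i + 1) (k * n) n : ℚ) =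
      n * (boundedPaths k t (k * n) n).card := by exact_mod_cast h
  rw [sum_congr rfl fun i hi => boundedDownSteps_eq_sub htk hn (Nat.le_add_left 1 i)
    (mem_range.mp hi), sum_sub_distrib, sum_const, card_range, sum_ite, sum_const_zero, zero_add,
    sum_const] at h'
  have hfilter : (range k).filter (fun i => ¬ k - t ≤ i + 1) = range (k - t - 1) := by
    ext i
    simp only [mem_filter, mem_range]
    omega
  have hcast : ((k - t - 1 : ℕ) : ℚ) = k - t - 1 := by
    rw [Nat.cast_sub (by omega), Nat.cast_sub htk.le, Nat.cast_one]
  rw [hfilter, card_range, nsmul_eq_mul, nsmul_eq_mul, hcast] at h'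
  linear_combination h'

/-! ### Closed forms -/

theorem card_boundedPaths_mul (htk : t < k) :
    ((boundedPaths k t (k * n) n).card : ℚ) * (k * n + t + 1) =
      (t + 1) * ((k + 1) * n + t).choose n := by
  have h := card_boundedPaths htk (k * n) n (by omega)
  rw [show k * n + t + n = (k + 1) * n + t by ring] at h
  push_cast at h
  linear_combination h

theorem card_boundedPaths_mul_add_one (htk : t < k) (m : ℕ) :
    ((boundedPaths k t (k * (m + 1) + 1) m).card : ℚ) * (k * (m + 1) + t + 2) =
      (k + t + 2) * ((k + 1) * (m + 1) + t).choose m := by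
  have h := card_boundedPaths htk (k * (m + 1) + 1) m (by nlinarith)
  rw [show k * (m + 1) + 1 + t + m = (k + 1) * (m + 1) + t by ring] at h
  push_cast at h
  linear_combination h

theorem boundedDownSteps_one (htk : t < k) : boundedDownSteps k t k (k * 1) 1 = 1 := by
  have h := mul_boundedDownSteps (n := 1) htk le_rfl
  have h1 := card_boundedPaths_mul (n := 1) htk
  rw [Nat.choose_one_right] at h1
  push_cast at h h1
  rw [card_boundedPaths_zero_right] at h
  have hk : (k : ℚ) ≠ 0 := by
    have : k ≠ 0 := by omega
    exact_mod_cast this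
  have hB : ((boundedPaths k t (k * 1) 1).card : ℚ) = t + 1 := by
    have hpos : (k : ℚ) + t + 1 ≠ 0 := by positivity
    apply mul_right_cancel₀ hpos
    linear_combination h1
  rw [hB] at h
  have : (boundedDownSteps k t k (k * 1) 1 : ℚ) = 1 := by
    apply mul_left_cancel₀ hk
    push_cast at h
    linear_combination h
  exact_mod_cast this

theorem card_boundedPaths_shift (htk : t < k) (m : ℕ) :
    ((boundedPaths k t (k * (m + 2) + 1) (m + 1)).card : ℚ) * (m + 1) =
      (k + t + 2) * ((k + 1) * (m + 2) + t).choose m := by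
  have h := card_boundedPaths_mul_add_one htk (m + 1)
  have hc := Nat.choose_succ_right_eq ((k + 1) * (m + 2) + t) m
  rw [show (k + 1) * (m + 2) + t - m = k * (m + 2) + t + 2 by
    rw [Nat.sub_eq_iff_eq_add (by nlinarith)]; ring] at hc
  have hc' : (((k + 1) * (m + 2) + t).choose (m + 1) : ℚ) * (m + 1) =
      ((k + 1) * (m + 2) + t).choose m * (k * (m + 2) + t + 2) := by exact_mod_cast hc
  have hpos : (k : ℚ) * (m + 2) + t + 2 ≠ 0 := by positivity
  apply mul_right_cancel₀ hpos
  rw [show m + 1 + 1 = m + 2 from rfl] at h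
  push_cast at h
  linear_combination ((m : ℚ) + 1) * h + (k + t + 2) * hc'

theorem boundedDownSteps_mul (htk : t < k) (m : ℕ) :
    (boundedDownSteps k t k (k * (m + 2)) (m + 2) : ℚ) * (m + 1) =
      ((t + 1) * (m + 2) + k + 1) * ((k + 1) * (m + 2) + t).choose m := by
  have h := mul_boundedDownSteps (n := m + 2) htk (by omega)
  have hB := card_boundedPaths_mul (n := m + 2) htk
  have hD := card_boundedPaths_shift htk m
  have hc := Nat.choose_succ_right_eq ((k + 1) * (m + 2) + t) m
  rw [show (k + 1) * (m + 2) + t - m = k * (m + 2) + t + 2 by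
    rw [Nat.sub_eq_iff_eq_add (by nlinarith)]; ring] at hc
  have hc' : (((k + 1) * (m + 2) + t).choose (m + 1) : ℚ) * (m + 1) =
      ((k + 1) * (m + 2) + t).choose m * (k * (m + 2) + t + 2) := by exact_mod_cast hc
  have he := Nat.choose_succ_right_eq ((k + 1) * (m + 2) + t) (m + 1)
  rw [show (k + 1) * (m + 2) + t - (m + 1) = k * (m + 2) + t + 1 by
    rw [Nat.sub_eq_iff_eq_add (by nlinarith)]; ring] at he
  have he' : (((k + 1) * (m + 2) + t).choose (m + 2) : ℚ) * (m + 2) =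
      ((k + 1) * (m + 2) + t).choose (m + 1) * (k * (m + 2) + t + 1) := by exact_mod_cast he
  rw [show m + 2 - 1 = m + 1 from rfl] at h
  push_cast at h hB
  set C := (((k + 1) * (m + 2) + t).choose (m + 1) : ℚ)
  -- With n = m + 2, the total number of down-steps is (t + 1) times the binomial coefficient with
  -- lower index n - 1.
  have hnB : ((m : ℚ) + 2) * (boundedPaths k t (k * (m + 2)) (m + 2)).card = (t + 1) * C := by
    have hpos : (k : ℚ) * (m + 2) + t + 1 ≠ 0 := by positivity
    apply mul_right_cancel₀ hpos
    linear_combination ((m : ℚ) + 2) * hB + (t + 1) * he'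
  have hk : (k : ℚ) ≠ 0 := by
    have : k ≠ 0 := by omega
    exact_mod_cast this
  apply mul_left_cancel₀ hk
  linear_combination ((m : ℚ) + 1) * h + (m + 1) * hnB + (k - t - 1) * hD + (t + 1) * hc'

end Residues

theorem totalDownStepsAt_eq {k t : ℕ} (htk : t < k) (n i : ℕ) :
    totalDownStepsAt k t n i = boundedDownSteps k t i (k * n) n := by
  rw [totalDownStepsAt, ktDyckPaths_eq_boundedPaths htk, boundedDownSteps]

end KtDyck

theorem theorem2p4 (k t n i : ℕ) (htk : t < k) (hi1 : 1 ≤ i) (hik : i ≤ k) :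
    (k - t ≤ i → n ≠ 1 →
      (KtDyck.totalDownStepsAt k t n i : ℚ) =
        (((t : ℚ) + 1) * n + k + 1) / ((n : ℚ) - 1) *
          (KtDyck.binom ((k + 1) * n + t) ((n : ℤ) - 2) : ℚ)) ∧
    (k - t ≤ i → n = 1 → KtDyck.totalDownStepsAt k t n i = 1) ∧
    (i ≤ k - t - 1 →
      KtDyck.totalDownStepsAt k t n i =
        (t + 1) * KtDyck.binom ((k + 1) * n + t) ((n : ℤ) - 2)) := by
  rw [KtDyck.totalDownStepsAt_eq htk]
  have hsub {n : ℕ} (hn : 1 ≤ n) := KtDyck.boundedDownSteps_eq_sub (n := n) htk hn hi1 hik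
  match n with
  -- The lower index is -2, so the binomial convention makes every right-hand side zero.
  | 0 => simp [KtDyck.boundedDownSteps_zero_right, KtDyck.binom]
  | 1 =>
    have h1 := hsub le_rfl
    rw [KtDyck.boundedDownSteps_one htk, KtDyck.card_boundedPaths_zero_right] at h1
    refine ⟨fun _ h => absurd rfl h, fun h _ => ?_, fun h => ?_⟩
    · rw [if_pos h] at h1
      rw [sub_zero] at h1
      exact_mod_cast h1
    · rw [if_neg (by omega)] at h1
      have h0 : KtDyck.boundedDownSteps k t i (k * 1) 1 = 0 := by
        rw [sub_self] at h1
        exact_mod_cast h1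
      rw [h0]
      simp [KtDyck.binom]
  | m + 2 =>
    have hb : KtDyck.binom ((k + 1) * (m + 2) + t) (((m + 2 : ℕ) : ℤ) - 2) =
        ((k + 1) * (m + 2) + t).choose m := by
      simp [KtDyck.binom]
    have h1 := hsub (n := m + 2) (by omega)
    have hA := KtDyck.boundedDownSteps_mul htk m
    have hD := KtDyck.card_boundedPaths_shift htk m
    have hpos : (m : ℚ) + 1 ≠ 0 := by positivity
    rw [hb]
    refine ⟨fun h _ => ?_, fun _ h => by omega, fun h => ?_⟩
    · rw [if_pos h, sub_zero] at h1
      rw [h1]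
      push_cast
      rw [show (m : ℚ) + 2 - 1 = m + 1 by ring, div_mul_eq_mul_div, eq_div_iff hpos, hA]
    · rw [if_neg (by omega), show m + 2 - 1 = m + 1 from rfl] at h1
      have : (KtDyck.boundedDownSteps k t i (k * (m + 2)) (m + 2) : ℚ) =
          (t + 1) * ((k + 1) * (m + 2) + t).choose m := by
        rw [h1]
        apply mul_right_cancel₀ hpos
        -- With n = m + 2, (t + 1)n + k + 1 - (k + t + 2) = (t + 1)(n - 1), which cancels the
        -- denominator.
        linear_combination hA - hD
      exact_mod_cast this
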